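/- Let $T\in\mathbb N$, let $(\Omega,\mathcal F,(\mathcal F_t)_{t=0,\dots,T},\mathbb P)$ be a filtered probability space with $\mathcal F_T=\mathcal F$, and put $\mathcal F_{T+1}:=\mathcal F_T$. Let $\mathbf V=(v^0,\dots,v^d)$ be a bounded random vector with strictly positive components whose Euclidean norm is bounded away from $0$, and suppose that some deterministic portfolio $\eta\in\mathbb R^{d+1}$ satisfies $\eta\cdot\mathbf V=1$ almost surely (for instance, $v^0=1$). Let $\mathcal Q$ be a set of probability measures absolutely continuous with respect to $\mathbb P$ whose set of densities $\{d\mathbb Q/d\mathbb P:\mathbb Q\in\mathcal Q\}$ is convex and closed in $L^1(\mathbb P)$. Put $$\rho(X)=\sup_{\mathbb Q\in\mathcal Q}\mathbb E_{\mathbb Q}[X],\qquad \mathcal A=\{X\in L^\infty:\rho(X)\le 0\},\qquad \mathcal A(\mathbf V)=\{Y\in L^\infty(\mathbb R^{d+1}): Y\cdot\mathbf V\in\mathcal A\},$$ $$\mathcal D=\mathcal A(\mathbf V)^*=\{Z\in L^1(\mathbb R^{d+1}):\mathbb E[Z\cdot Y]\le 0\ \text{ for all } Y\in\mathcal A(\mathbf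 V)\}.$$ For a stopping time $\tau$ with values in $\{0,\dots,T\}$ and probability measures $\mathbb Q^1,\mathbb Q^2\ll\mathbb P$, an *optional pasting* of $\mathbb Q^1$ and $\mathbb Q^2$ at $\tau$ is a probability measure $\widetilde{\mathbb Q}\ll\mathbb P$ such that $\widetilde{\mathbb Q}=\mathbb Q^1$ on $\mathcal F_\tau$ and $\widetilde{\mathbb Q}(A\mid\mathcal F_{(\tau+1)\wedge T})=\mathbb Q^2(A\mid\mathcal F_{(\tau+1)\wedge T})$ for all $A\in\mathcal F_T$. On $\{\tau=T\}$ the last identity is automatic, both sides being $\mathbf 1_A$; on $\{\tau<T\}$ it is required $\widetilde{\mathbb Q}$-almost surely, and it is understood to include that $\widetilde{\mathbb Q}(B)=0$ for every $B\in\mathcal F_{(\tau+1)\wedge T}$ with $B\subseteq\{\tau<T\}$ and $\mathbb Q^2(B)=0$. The set $\mathcal Q$ is *optionally $\mathbf V$-m-stable* if, for every stopping time $\tau$ with values in $\{0,\dots,T\}$ and all $\mathbb Q^1,\mathbb Q^2\in\mathcal Q$, it contains every optional pasting $\widetilde{\mathbb Q}$ of $\mathbb Q^1$ and $\mathbb Q^2$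 at $\tau$ for which $\mathbb E_{\widetilde{\mathbb Q}}[\mathbf V\mid\mathcal F_\tau]=\mathbb E_{\mathbb Q^1}[\mathbf V\mid\mathcal F_\tau]$. Then the following are equivalent. (i) $\mathcal Q$ is optionally $\mathbf V$-m-stable. (ii) For each $t\in\{0,1,\dots,T\}$: whenever $Y,W,Z\in\mathcal D$, $F\in\mathcal F_t$, and $\alpha,\beta$ are nonnegative $\mathcal F_{t+1}$-measurable random variables such that $\alpha Y,\beta W\in L^1(\mathbb R^{d+1})$ and $X:=\mathbf 1_F\,\alpha Y+\mathbf 1_{F^c}\,\beta W$ satisfies $\mathbb E[X\mid\mathcal F_t]=\mathbb E[Z\mid\mathcal F_t]$, then $X\in\mathcal D$. -/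

import Mathlib

open MeasureTheory
open scoped ENNReal

/-- Assumptions on the vector `V = (v⁰, …, v^d)` of terminal values of the numéraires: measurable,
strictly positive, bounded, with Euclidean norm bounded away from `0`. -/
structure IsNumeraireVector {Ω : Type*} [MeasurableSpace Ω] (P : Measure Ω) {d : ℕ}
    (V : Ω → EuclideanSpace ℝ (Fin (d + 1))) : Prop where
  measurable : Measurable V
  pos : ∀ i, ∀ᵐ ω ∂P, 0 < V ω i
  bounded : ∃ C : ℝ, ∀ᵐ ω ∂P, ‖V ω‖ ≤ C
  away_from_zero : ∃ c : ℝ, 0 < c ∧ ∀ᵐ ω ∂P, c ≤ ‖V ω‖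

/-- The set of densities `dQ/dP`, `Q ∈ 𝒬`, as a subset of the Banach space `L¹(P)`. -/
def densitySet {Ω : Type*} [MeasurableSpace Ω] (P : Measure Ω) (𝒬 : Set (Measure Ω)) :
    Set (Lp ℝ 1 P) :=
  {f | ∃ Q ∈ 𝒬, f =ᵐ[P] fun ω => (Q.rnDeriv P ω).toReal}

/-- The coherent risk measure `ρ(X) = sup_{Q ∈ 𝒬} E_Q[X]` represented by `𝒬`. -/
noncomputable def coherentRisk {Ω : Type*} [MeasurableSpace Ω] (𝒬 : Set (Measure Ω))
    (X : Ω → ℝ) : ℝ :=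
  sSup ((fun Q : Measure Ω => ∫ ω, X ω ∂Q) '' 𝒬)

/-- The acceptance set `𝒜 = {X ∈ L^∞ : ρ(X) ≤ 0}`. -/
def acceptanceSet {Ω : Type*} [MeasurableSpace Ω] (P : Measure Ω) (𝒬 : Set (Measure Ω)) :
    Set (Ω → ℝ) :=
  {X | MemLp X ∞ P ∧ coherentRisk 𝒬 X ≤ 0}

/-- The portfolios attaining a set of claims: `𝒜(V) = {Y ∈ L^∞(ℝ^{d+1}) : Y · V ∈ 𝒜}`. -/
def attainingPortfolios {Ω : Type*} [MeasurableSpace Ω] (P : Measure Ω) {d : ℕ}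
    (V : Ω → EuclideanSpace ℝ (Fin (d + 1))) (A : Set (Ω → ℝ)) :
    Set (Ω → EuclideanSpace ℝ (Fin (d + 1))) :=
  {Y | MemLp Y ∞ P ∧ (fun ω => inner ℝ (Y ω) (V ω)) ∈ A}

/-- The dual (polar) cone `B^* = {Z ∈ L¹(ℝ^{d+1}) : E[Z · Y] ≤ 0 for all Y ∈ B}`. -/
def dualCone {Ω : Type*} [MeasurableSpace Ω] (P : Measure Ω) {d : ℕ}
    (B : Set (Ω → EuclideanSpace ℝ (Fin (d + 1)))) :
    Set (Ω → EuclideanSpace ℝ (Fin (d + 1))) :=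
  {Z | Integrable Z P ∧ ∀ Y ∈ B, ∫ ω, inner ℝ (Z ω) (Y ω) ∂P ≤ 0}

/-- The σ-algebra at the stopping time `(τ + 1) ∧ T`. -/
abbrev nextSigma {Ω : Type*} {mΩ : MeasurableSpace Ω} {ℱ : Filtration ℕ mΩ} (T : ℕ)
    {τ : Ω → WithTop ℕ} (hτ : IsStoppingTime ℱ τ) : MeasurableSpace Ω :=
  ((hτ.add_const' 1).min_const T).measurableSpace

/-- `Q'` is an optional pasting of `Q₁` and `Q₂` at the stopping time `τ`: it is a probability
measure, absolutely continuous with respect to `P`, that agrees with `Q₁` on `ℱ_τ` and has the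
conditional probabilities of `Q₂` given `ℱ_{(τ+1) ∧ T}`.

The last clause concerns `{τ < T}` only: on `{τ = T}` both conditional probabilities of `A` are the
indicator of `A`.  As a conditional probability under `Q₂` is determined up to `Q₂`-null sets only,
equality `Q'`-almost surely includes that `Q'` does not charge the `Q₂`-null events of
`ℱ_{(τ+1) ∧ T}` inside `{τ < T}`. -/
structure IsOptionalPasting {Ω : Type*} {mΩ : MeasurableSpace Ω} (P : Measure Ω)
    {ℱ : Filtration ℕ mΩ} (T : ℕ) {τ : Ω → WithTop ℕ} (hτ : IsStoppingTime ℱ τ)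
    (Q₁ Q₂ Q' : Measure Ω) : Prop where
  isProbabilityMeasure : IsProbabilityMeasure Q'
  absolutelyContinuous : Q' ≪ P
  agree : ∀ A, MeasurableSet[hτ.measurableSpace] A → Q' A = Q₁ A
  null : ∀ B, MeasurableSet[nextSigma T hτ] B → B ⊆ {ω | τ ω < T} → Q₂ B = 0 → Q' B = 0
  condProb : ∀ A, MeasurableSet A →
    ∀ᵐ ω ∂Q', τ ω < T →
      (Q'[A.indicator (fun _ => (1 : ℝ)) | nextSigma T hτ]) ω =
        (Q₂[A.indicator (fun _ => (1 : ℝ)) | nextSigma T hτ]) ω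

/-- `𝒬` is optionally `V`-m-stable: it contains every optional pasting `Q'` of two of its elements
at a stopping time `τ` with values in `{0, …, T}` such that `E_{Q'}[V | ℱ_τ] = E_{Q₁}[V | ℱ_τ]`.
(`Q'` and `Q₁` agree on `ℱ_τ`, so almost sure equality means the same under both.) -/
def IsOptionallyMStable {Ω : Type*} {mΩ : MeasurableSpace Ω} (P : Measure Ω)
    (ℱ : Filtration ℕ mΩ) (T : ℕ) {d : ℕ} (V : Ω → EuclideanSpace ℝ (Fin (d + 1)))
    (𝒬 : Set (Measure Ω)) : Prop :=
  ∀ (τ : Ω → WithTop ℕ) (hτ : IsStoppingTime ℱ τ), (∀ ω, τ ω ≤ T) →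
    ∀ Q₁ ∈ 𝒬, ∀ Q₂ ∈ 𝒬, ∀ Q' : Measure Ω, IsOptionalPasting P T hτ Q₁ Q₂ Q' →
      Q'[V | hτ.measurableSpace] =ᵐ[Q₁] Q₁[V | hτ.measurableSpace] →
      Q' ∈ 𝒬

/-- Closedness of a cone `D` of integrable random vectors under the time-`t` pastings
`X = 1_F α Y + 1_{Fᶜ} β W` whose conditional expectation given `ℱ_t` is that of an element of `D`;
here `ℱ_{T+1} = ℱ_T`. -/
def IsPastingStable {Ω : Type*} {mΩ : MeasurableSpace Ω} (P : Measure Ω)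
    (ℱ : Filtration ℕ mΩ) (T : ℕ) {d : ℕ}
    (D : Set (Ω → EuclideanSpace ℝ (Fin (d + 1)))) : Prop :=
  ∀ t ≤ T, ∀ Y ∈ D, ∀ W ∈ D, ∀ Z ∈ D, ∀ F : Set Ω, MeasurableSet[ℱ t] F →
    ∀ α β : Ω → ℝ, Measurable[ℱ (min (t + 1) T)] α → Measurable[ℱ (min (t + 1) T)] β →
      (∀ ω, 0 ≤ α ω) → (∀ ω, 0 ≤ β ω) →
      Integrable (fun ω => α ω • Y ω) P → Integrable (fun ω => β ω • W ω) P →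
      P[F.indicator (fun ω => α ω • Y ω) + Fᶜ.indicator (fun ω => β ω • W ω) | ℱ t]
        =ᵐ[P] P[Z | ℱ t] →
      F.indicator (fun ω => α ω • Y ω) + Fᶜ.indicator (fun ω => β ω • W ω) ∈ D

/-! The bridge between measures and portfolios is a bipolar theorem: for nonempty `𝒬`, the cone `D`
consists, up to null sets, of the vectors `c · dQ/dP · V` with `c ≥ 0` and `Q ∈ 𝒬`
(`smul_density_mem_dualCone`, `exists_eq_smul_density_of_mem_dualCone`). Portfolios of value `Y · V
= 0` are acceptable, which forces elements of `D` to be parallel to `V`. What remains is scalar: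
Hahn–Banach separation from the convex closed set of densities in `L¹`, whose dual is `L^∞`.

(i) ⇒ (ii): write `q_Y, q_W, q_Z` for the densities and `z` for the multiple belonging to `Z`. If `z
> 0`, then `X / z` arises from `q_Z V` by replacing the density on `F` by a multiple of `q_Y` and on
`Fᶜ` by a multiple of `q_W`. Each replacement is an optional pasting at the time equal to `t` on one
set and `T` on the other (`IsOptionallyMStable.exists_density_eq`). Agreement of the measures on
`ℱ_τ` follows from the identity for `V` by pairing it with `η`. If `z = 0`, the same pairing forces
`X = 0`.

(ii) ⇒ (i): an optional pasting has density `γ · dQ₂/dP` on `{τ < T}`, with `γ` measurable at time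
`(τ+1) ∧ T`, and `dQ₁/dP` on `{τ = T}`. Replacing the density of `Q₁` on `{τ = 0}`, `{τ = 1}`, … in
turn uses one fixed-time pasting each, so `dQ'/dP · V` lies in `D`; by the bipolar theorem `Q'` is a
multiple of an element of `𝒬`, and both have mass one. -/

/-- A continuous linear functional on `L¹` of a finite measure is integration against a bounded
measurable function. -/
theorem exists_bounded_integral_repr {Ω : Type*} [MeasurableSpace Ω] (P : Measure Ω)
    [IsFiniteMeasure P] (Λ : Lp ℝ 1 P →L[ℝ] ℝ) :
    ∃ g : Ω → ℝ, MemLp g ∞ P ∧ ∀ f : Lp ℝ 1 P, Λ f = ∫ ω, g ω * f ω ∂P := by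
  -- Since `P` is finite, `L²` embeds in `L¹`, here as the Hölder product with `1`. The Riesz
  -- representation of the functional restricted to `L²` yields `g`.
  let one : Lp ℝ 2 P := (memLp_const (1 : ℝ)).toLp _
  have hone : one =ᵐ[P] fun _ => (1 : ℝ) := MemLp.coeFn_toLp _
  let ι : Lp ℝ 2 P →L[ℝ] Lp ℝ 1 P := (ContinuousLinearMap.mul ℝ ℝ).holderL P 2 2 1 one
  have hι : ∀ h : Lp ℝ 2 P, ι h =ᵐ[P] h := fun h => by
    have := (ContinuousLinearMap.mul ℝ ℝ).coeFn_holder (r := 1) one h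
    filter_upwards [this, hone] with ω h1 h2
    change ((ContinuousLinearMap.mul ℝ ℝ).holder 1 one h : Ω → ℝ) ω = _
    rw [h1, h2]; simp
  let g : Lp ℝ 2 P := (InnerProductSpace.toDual ℝ (Lp ℝ 2 P)).symm (Λ.comp ι)
  have hg : ∀ h : Lp ℝ 2 P, Λ (ι h) = ∫ ω, g ω * h ω ∂P := fun h => by
    have : inner ℝ g h = Λ (ι h) := by
      simp [g, InnerProductSpace.toDual_symm_apply]
    rw [← this, L2.inner_def]
    simp [mul_comm]
  have hgi : Integrable g P := (Lp.memLp g).integrable (by norm_num)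
  have hind : ∀ (s : Set Ω) (hs : MeasurableSet s) (c : ℝ),
      Λ (indicatorConstLp 1 hs (measure_ne_top P s) c) = ∫ ω in s, c * g ω ∂P := by
    intro s hs c
    have e : ι (indicatorConstLp 2 hs (measure_ne_top P s) c)
        = indicatorConstLp 1 hs (measure_ne_top P s) c := by
      apply Lp.ext
      exact (hι _).trans (indicatorConstLp_coeFn.trans indicatorConstLp_coeFn.symm)
    rw [← e, hg, ← integral_indicator hs]
    apply integral_congr_ae
    filter_upwards [indicatorConstLp_coeFn (p := 2) (hs := hs) (hμs := measure_ne_top P s) (c := c)]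
      with ω h
    rw [h]
    by_cases hω : ω ∈ s <;> simp [hω, mul_comm]
  -- Testing on indicators with `c = 1` and `c = -1` bounds `g` from both sides by `‖Λ‖`.
  have hbd : ∀ c : ℝ, |c| = 1 → ∀ᵐ ω ∂P, c * g ω ≤ ‖Λ‖ := by
    intro c hc
    apply ae_le_of_forall_setIntegral_le (hgi.const_mul c) (integrable_const _)
    intro s hs _
    rw [← hind s hs c]
    refine (le_abs_self _).trans ((Λ.le_opNorm _).trans ?_)
    rw [norm_indicatorConstLp (by simp) (by simp)]
    simp [hc, mul_comm]
  have hgb : ∀ᵐ ω ∂P, ‖g ω‖ ≤ ‖Λ‖ := by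
    filter_upwards [hbd 1 (by simp), hbd (-1) (by simp)] with ω h1 h2
    rw [Real.norm_eq_abs, abs_le]
    constructor <;> linarith
  have hgm : MemLp g ∞ P := memLp_top_of_bound (Lp.aestronglyMeasurable g) _ hgb
  refine ⟨g, hgm, ?_⟩
  let Γ : Lp ℝ 1 P →L[ℝ] ℝ :=
    (L1.integralCLM (α := Ω) (E := ℝ) (μ := P)).comp
      ((ContinuousLinearMap.mul ℝ ℝ).holderL P ∞ 1 1 (hgm.toLp _))
  have hΓ : ∀ f : Lp ℝ 1 P, Γ f = ∫ ω, g ω * f ω ∂P := fun f => by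
    change L1.integralCLM (α := Ω) (E := ℝ) (μ := P)
      ((ContinuousLinearMap.mul ℝ ℝ).holder 1 (hgm.toLp _) f) = _
    rw [← L1.integral_eq, L1.integral_eq_integral]
    apply integral_congr_ae
    filter_upwards [(ContinuousLinearMap.mul ℝ ℝ).coeFn_holder (r := 1) (hgm.toLp _) f,
      hgm.coeFn_toLp] with ω h1 h2
    rw [h1, h2]; simp
  have key : ∀ f : Lp ℝ 1 P, Λ f = Γ f := by
    intro f
    induction f using Lp.induction (by simp : (1 : ℝ≥0∞) ≠ ∞) with
    | @indicatorConst c s hs hμ =>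
      rw [Lp.simpleFunc.coe_indicatorConst, hind, hΓ, ← integral_indicator hs]
      apply integral_congr_ae
      filter_upwards [indicatorConstLp_coeFn (p := 1) (hs := hs) (hμs := hμ.ne) (c := c)] with ω h
      rw [h]
      by_cases hω : ω ∈ s <;> simp [hω, mul_comm]
    | add hf hg _ h1 h2 => rw [map_add, map_add, h1, h2]
    | isClosed => exact isClosed_eq Λ.continuous Γ.continuous
  intro f
  rw [key, hΓ]

/-! ### The dual cone and the bipolar theorem. -/

section DualCone

variable {Ω : Type*} {mΩ : MeasurableSpace Ω} {P : Measure Ω} {d : ℕ}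
  {V : Ω → EuclideanSpace ℝ (Fin (d + 1))} {𝒬 : Set (Measure Ω)}

theorem MemLp.exists_ae_norm_le {E : Type*} [NormedAddCommGroup E] {X : Ω → E}
    (hX : MemLp X ∞ P) : ∃ C : ℝ, ∀ᵐ ω ∂P, ‖X ω‖ ≤ C := by
  refine ⟨(eLpNorm X ∞ P).toReal, ?_⟩
  have h : eLpNorm X ∞ P = eLpNormEssSup X P := eLpNorm_exponent_top
  filter_upwards [ae_le_eLpNormEssSup (f := X) (μ := P)] with ω hω
  rw [← h] at hω
  rw [← toReal_enorm]
  exact ENNReal.toReal_mono hX.2.ne hω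

theorem MemLp.integrable_of_absolutelyContinuous {E : Type*} [NormedAddCommGroup E] {X : Ω → E}
    (hX : MemLp X ∞ P) {Q : Measure Ω} [IsFiniteMeasure Q] (hQ : Q ≪ P) : Integrable X Q := by
  obtain ⟨C, hC⟩ := MemLp.exists_ae_norm_le hX
  exact Integrable.of_bound (hX.1.mono_ac hQ) C (hQ.ae_le hC)

theorem IsNumeraireVector.memLp_top (hV : IsNumeraireVector P V) : MemLp V ∞ P :=
  let ⟨C, hC⟩ := hV.bounded
  memLp_top_of_bound hV.measurable.aestronglyMeasurable C hC

theorem IsNumeraireVector.integrable (hV : IsNumeraireVector P V) {Q : Measure Ω}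
    [IsFiniteMeasure Q] (hQ : Q ≪ P) : Integrable V Q :=
  MemLp.integrable_of_absolutelyContinuous hV.memLp_top hQ

theorem IsNumeraireVector.ae_ne_zero (hV : IsNumeraireVector P V) : ∀ᵐ ω ∂P, V ω ≠ 0 := by
  obtain ⟨c, hc, h⟩ := hV.away_from_zero
  filter_upwards [h] with ω hω h0
  rw [h0, norm_zero] at hω
  linarith

theorem IsNumeraireVector.integrable_smul (hV : IsNumeraireVector P V) {f : Ω → ℝ}
    (hf : Integrable f P) : Integrable (fun ω => f ω • V ω) P :=
  let ⟨C, hC⟩ := hV.bounded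
  hf.smul_bdd C hV.measurable.aestronglyMeasurable hC

/-- The scalar is recovered as `⟨f V, V⟩ / ‖V‖²`, and the lower bound `c` on `‖V‖` gives `|f| ≤ ‖f
V‖ / c`. -/
theorem integrable_of_integrable_smul (hV : IsNumeraireVector P V) {f : Ω → ℝ}
    (hf : Integrable (fun ω => f ω • V ω) P) : Integrable f P := by
  obtain ⟨c, hc, h⟩ := hV.away_from_zero
  have hm : AEStronglyMeasurable f P := by
    have h1 : AEStronglyMeasurable (fun ω => (‖V ω‖ ^ 2)⁻¹ * inner ℝ (f ω • V ω) (V ω)) P := by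
      refine AEStronglyMeasurable.mul ?_ (hf.1.inner hV.measurable.aestronglyMeasurable)
      exact (hV.measurable.norm.pow_const 2).inv.aestronglyMeasurable
    refine h1.congr ?_
    filter_upwards [hV.ae_ne_zero] with ω hω
    have : ‖V ω‖ ≠ 0 := norm_ne_zero_iff.2 hω
    rw [real_inner_smul_left, real_inner_self_eq_norm_sq]
    field_simp
  refine (hf.norm.const_mul c⁻¹).mono' hm ?_
  filter_upwards [h] with ω hω
  rw [norm_smul]
  calc ‖f ω‖ = c⁻¹ * (‖f ω‖ * c) := by field_simp
    _ ≤ _ := by gcongr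

/-- The risk of a bounded claim is acceptable iff all expectations are nonpositive. -/
theorem coherentRisk_nonpos_iff (h𝒬 : ∀ Q ∈ 𝒬, IsProbabilityMeasure Q ∧ Q ≪ P)
    {X : Ω → ℝ} (hX : MemLp X ∞ P) :
    coherentRisk 𝒬 X ≤ 0 ↔ ∀ Q ∈ 𝒬, ∫ ω, X ω ∂Q ≤ 0 := by
  constructor
  · intro h Q hQ
    -- An essential bound of `X` bounds all expectations, so `sSup` is a genuine supremum here.
    refine le_trans (le_csSup ?_ (Set.mem_image_of_mem (fun Q : Measure Ω => ∫ ω, X ω ∂Q) hQ)) h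
    obtain ⟨C, hC⟩ := MemLp.exists_ae_norm_le hX
    refine ⟨C, ?_⟩
    rintro _ ⟨Q, hQ, rfl⟩
    have := (h𝒬 Q hQ).1
    have hi := MemLp.integrable_of_absolutelyContinuous hX (h𝒬 Q hQ).2
    have : ∫ ω, X ω ∂Q ≤ ∫ _, C ∂Q := by
      apply integral_mono_ae hi (integrable_const _)
      filter_upwards [(h𝒬 Q hQ).2.ae_le hC] with ω hω using (le_abs_self _).trans hω
    simpa using this
  · intro h
    -- This covers empty `𝒬` as well, where `sSup ∅ = 0` makes every bounded claim acceptable.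
    apply Real.sSup_nonpos
    rintro _ ⟨Q, hQ, rfl⟩
    exact h Q hQ

theorem integral_eq_integral_density_smul {E : Type*} [NormedAddCommGroup E] [NormedSpace ℝ E]
    [IsFiniteMeasure P] {Q : Measure Ω} [IsFiniteMeasure Q] (hQ : Q ≪ P) (X : Ω → E) :
    ∫ ω, X ω ∂Q = ∫ ω, (Q.rnDeriv P ω).toReal • X ω ∂P :=
  (integral_rnDeriv_smul hQ).symm

theorem smul_density_mem_dualCone [IsFiniteMeasure P] (hV : IsNumeraireVector P V)
    (h𝒬 : ∀ Q ∈ 𝒬, IsProbabilityMeasure Q ∧ Q ≪ P) {Q : Measure Ω} (hQ : Q ∈ 𝒬) {c : ℝ}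
    (hc : 0 ≤ c) {Z : Ω → EuclideanSpace ℝ (Fin (d + 1))}
    (hZ : Z =ᵐ[P] fun ω => (c * (Q.rnDeriv P ω).toReal) • V ω) :
    Z ∈ dualCone P (attainingPortfolios P V (acceptanceSet P 𝒬)) := by
  have := (h𝒬 Q hQ).1
  refine ⟨(hV.integrable_smul (Measure.integrable_toReal_rnDeriv.const_mul c)).congr hZ.symm, ?_⟩
  rintro Y ⟨_, hA, hr⟩
  have h1 := (coherentRisk_nonpos_iff h𝒬 hA).1 hr Q hQ
  rw [integral_eq_integral_density_smul (h𝒬 Q hQ).2] at h1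
  calc ∫ ω, inner ℝ (Z ω) (Y ω) ∂P
      = ∫ ω, c * ((Q.rnDeriv P ω).toReal • inner ℝ (Y ω) (V ω)) ∂P := by
        apply integral_congr_ae
        filter_upwards [hZ] with ω hω
        rw [hω, real_inner_smul_left, real_inner_comm, smul_eq_mul, mul_assoc]
    _ = c * _ := integral_const_mul _ _
    _ ≤ 0 := mul_nonpos_of_nonneg_of_nonpos hc h1

/-- Elements of the dual cone are pointwise multiples of `V`. -/
theorem exists_eq_smul_of_mem_dualCone (hV : IsNumeraireVector P V)
    (h𝒬 : ∀ Q ∈ 𝒬, IsProbabilityMeasure Q ∧ Q ≪ P)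
    {Z : Ω → EuclideanSpace ℝ (Fin (d + 1))}
    (hZ : Z ∈ dualCone P (attainingPortfolios P V (acceptanceSet P 𝒬))) :
    ∃ φ : Ω → ℝ, Integrable φ P ∧ Z =ᵐ[P] fun ω => φ ω • V ω := by
  obtain ⟨hZi, hZ⟩ := hZ
  have hVm : AEStronglyMeasurable V P := hV.measurable.aestronglyMeasurable
  -- `φ V` is the pointwise projection of `Z` onto `V`, and `R` below is the orthogonal remainder,
  -- to be shown null.
  let φ : Ω → ℝ := fun ω => (‖V ω‖ ^ 2)⁻¹ * inner ℝ (Z ω) (V ω)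
  have hφm : AEStronglyMeasurable φ P :=
    (hV.measurable.norm.pow_const 2).inv.aestronglyMeasurable.mul (hZi.1.inner hVm)
  let R : Ω → EuclideanSpace ℝ (Fin (d + 1)) := fun ω => Z ω - φ ω • V ω
  have hR0 : ∀ ω, inner ℝ (R ω) (V ω) = 0 := fun ω => by
    by_cases h : V ω = 0
    · simp [h]
    · have : ‖V ω‖ ≠ 0 := norm_ne_zero_iff.2 h
      simp only [R, φ, inner_sub_left, real_inner_smul_left, real_inner_self_eq_norm_sq]
      field_simp
      ring
  have hZR : ∀ ω, inner ℝ (Z ω) (R ω) = ‖R ω‖ ^ 2 := fun ω => by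
    have : Z ω = R ω + φ ω • V ω := by simp [R]
    rw [this, inner_add_left, real_inner_smul_left, real_inner_comm, real_inner_comm (R ω) (V ω),
      hR0, mul_zero, add_zero, real_inner_self_eq_norm_sq]
  have hRZ : ∀ ω, ‖R ω‖ ≤ ‖Z ω‖ := fun ω => by
    by_cases h : ‖R ω‖ = 0
    · rw [h]; positivity
    · have h1 := real_inner_le_norm (Z ω) (R ω)
      rw [hZR, sq] at h1
      exact le_of_mul_le_mul_right h1 (lt_of_le_of_ne (norm_nonneg _) (Ne.symm h))
  -- The remainder, scaled to be bounded, is a portfolio of value zero, hence acceptable; its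
  -- pairing with `Z` is `‖R‖² / (1 + ‖Z‖) ≥ 0`.
  let Y : Ω → EuclideanSpace ℝ (Fin (d + 1)) := fun ω => (1 + ‖Z ω‖)⁻¹ • R ω
  have hRm : AEStronglyMeasurable R P := hZi.1.sub (hφm.smul hVm)
  have hYm : AEStronglyMeasurable Y P :=
    AEStronglyMeasurable.smul
      (((aemeasurable_const.add hZi.1.norm.aemeasurable).inv).aestronglyMeasurable) hRm
  have hYb : ∀ ω, ‖Y ω‖ ≤ 1 := fun ω => by
    have h0 : 0 < 1 + ‖Z ω‖ := by positivity
    rw [norm_smul, norm_inv, Real.norm_of_nonneg h0.le, inv_mul_le_iff₀ h0]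
    linarith [hRZ ω]
  have hYV : ∀ ω, inner ℝ (Y ω) (V ω) = 0 := fun ω => by
    simp [Y, real_inner_smul_left, hR0]
  have hYA : Y ∈ attainingPortfolios P V (acceptanceSet P 𝒬) := by
    have h0 : (fun ω => inner ℝ (Y ω) (V ω)) = fun _ => (0 : ℝ) := funext hYV
    have hm : MemLp (fun _ : Ω => (0 : ℝ)) ∞ P := MemLp.zero'
    refine ⟨memLp_top_of_bound hYm 1 (.of_forall hYb), ?_⟩
    rw [h0]
    exact ⟨hm, (coherentRisk_nonpos_iff h𝒬 hm).2 (by simp)⟩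
  have hZY : ∀ ω, inner ℝ (Z ω) (Y ω) = (1 + ‖Z ω‖)⁻¹ * ‖R ω‖ ^ 2 := fun ω => by
    simp only [Y, real_inner_smul_right, hZR]
  have hint : Integrable (fun ω => inner ℝ (Z ω) (Y ω)) P := by
    refine hZi.norm.mono' (hZi.1.inner hYm) (.of_forall fun ω => ?_)
    refine (norm_inner_le_norm _ _).trans ?_
    exact mul_le_of_le_one_right (norm_nonneg _) (hYb ω)
  have hnn : 0 ≤ fun ω => inner ℝ (Z ω) (Y ω) := fun ω => by
    simp only [hZY]; positivity
  have hzero := (integral_eq_zero_iff_of_nonneg hnn hint).1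
    (le_antisymm (hZ Y hYA) (integral_nonneg hnn))
  have hZφ : Z =ᵐ[P] fun ω => φ ω • V ω := by
    filter_upwards [hzero] with ω hω
    simp only [hZY, Pi.zero_apply] at hω
    have h0 : (1 + ‖Z ω‖)⁻¹ ≠ 0 := by positivity
    have : ‖R ω‖ ^ 2 = 0 := by simpa [h0] using hω
    have : R ω = 0 := by simpa using this
    simpa [R, sub_eq_zero] using this
  exact ⟨φ, integrable_of_integrable_smul hV (hZi.congr hZφ), hZφ⟩

theorem integral_mul_nonpos_of_smul_mem_dualCone (hV : IsNumeraireVector P V)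
    (h𝒬 : ∀ Q ∈ 𝒬, IsProbabilityMeasure Q ∧ Q ≪ P)
    {Z : Ω → EuclideanSpace ℝ (Fin (d + 1))} {φ : Ω → ℝ}
    (hZ : Z ∈ dualCone P (attainingPortfolios P V (acceptanceSet P 𝒬)))
    (hφ : Z =ᵐ[P] fun ω => φ ω • V ω)
    {X : Ω → ℝ} (hX : MemLp X ∞ P) (hXQ : ∀ Q ∈ 𝒬, ∫ ω, X ω ∂Q ≤ 0) :
    ∫ ω, φ ω * X ω ∂P ≤ 0 := by
  obtain ⟨c, hc, hcV⟩ := hV.away_from_zero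
  obtain ⟨C, hC⟩ := MemLp.exists_ae_norm_le hX
  have hVm : AEStronglyMeasurable V P := hV.measurable.aestronglyMeasurable
  -- A portfolio worth exactly `X`, bounded because `‖V‖ ≥ c`.
  let Y : Ω → EuclideanSpace ℝ (Fin (d + 1)) := fun ω => (X ω * (‖V ω‖ ^ 2)⁻¹) • V ω
  have hYm : AEStronglyMeasurable Y P :=
    (hX.1.mul (hV.measurable.norm.pow_const 2).inv.aestronglyMeasurable).smul hVm
  have hYV : (fun ω => inner ℝ (Y ω) (V ω)) =ᵐ[P] X := by
    filter_upwards [hV.ae_ne_zero] with ω hω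
    have : ‖V ω‖ ≠ 0 := norm_ne_zero_iff.2 hω
    simp only [Y, real_inner_smul_left, real_inner_self_eq_norm_sq]
    field_simp
  have hYb : ∀ᵐ ω ∂P, ‖Y ω‖ ≤ C * c⁻¹ := by
    filter_upwards [hC, hcV] with ω h1 h2
    have hpos : 0 < ‖V ω‖ := hc.trans_le h2
    have : ‖Y ω‖ = ‖X ω‖ * ‖V ω‖⁻¹ := by
      simp only [Y, norm_smul, norm_mul, norm_inv, norm_pow, norm_norm]
      field_simp
    rw [this]
    have h0 := norm_nonneg (X ω)
    gcongr
    linarith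
  have hYA : Y ∈ attainingPortfolios P V (acceptanceSet P 𝒬) := by
    have hm := hX.ae_eq hYV.symm
    refine ⟨memLp_top_of_bound hYm _ hYb, hm, (coherentRisk_nonpos_iff h𝒬 hm).2 fun Q hQ => ?_⟩
    rw [integral_congr_ae ((h𝒬 Q hQ).2.ae_eq hYV)]
    exact hXQ Q hQ
  refine le_trans (le_of_eq (integral_congr_ae ?_)) (hZ.2 Y hYA)
  filter_upwards [hφ, hYV] with ω h1 h2
  rw [h1, real_inner_smul_left, real_inner_comm, h2]

/-- The bipolar theorem for the cone spanned by `{dQ/dP · V : Q ∈ 𝒬}`. -/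
theorem exists_eq_smul_density_of_mem_dualCone [IsFiniteMeasure P] (hV : IsNumeraireVector P V)
    (hne : 𝒬.Nonempty) (h𝒬 : ∀ Q ∈ 𝒬, IsProbabilityMeasure Q ∧ Q ≪ P)
    (hconvex : Convex ℝ (densitySet P 𝒬)) (hclosed : IsClosed (densitySet P 𝒬))
    {Z : Ω → EuclideanSpace ℝ (Fin (d + 1))}
    (hZ : Z ∈ dualCone P (attainingPortfolios P V (acceptanceSet P 𝒬))) :
    ∃ c : ℝ, 0 ≤ c ∧ ∃ Q ∈ 𝒬, Z =ᵐ[P] fun ω => (c * (Q.rnDeriv P ω).toReal) • V ω := by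
  obtain ⟨φ, hφi, hφ⟩ := exists_eq_smul_of_mem_dualCone hV h𝒬 hZ
  have hpol : ∀ X : Ω → ℝ, MemLp X ∞ P → (∀ Q ∈ 𝒬, ∫ ω, X ω ∂Q ≤ 0) → ∫ ω, φ ω * X ω ∂P ≤ 0 :=
    fun X hX hXQ => integral_mul_nonpos_of_smul_mem_dualCone hV h𝒬 hZ hφ hX hXQ
  have hφ0 : 0 ≤ᵐ[P] φ := by
    apply ae_nonneg_of_forall_setIntegral_nonneg hφi
    intro s hs _
    -- Nonpositive claims are acceptable, so testing with `-1_s` gives the sign of `φ`.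
    have h := hpol (s.indicator fun _ => (-1 : ℝ)) ((memLp_const _).indicator hs) fun Q hQ =>
      integral_nonpos fun ω => by by_cases hω : ω ∈ s <;> simp [hω]
    rw [← integral_indicator hs]
    have e : ∀ ω, φ ω * s.indicator (fun _ => (-1 : ℝ)) ω = -s.indicator φ ω := fun ω => by
      by_cases hω : ω ∈ s <;> simp [hω]
    simp only [e, integral_neg] at h
    linarith
  have hm0 : 0 ≤ ∫ ω, φ ω ∂P := integral_nonneg_of_ae hφ0
  rcases hm0.eq_or_lt with hm | hm
  · obtain ⟨Q, hQ⟩ := hne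
    refine ⟨0, le_rfl, Q, hQ, ?_⟩
    have := (integral_eq_zero_iff_of_nonneg_ae hφ0 hφi).1 hm.symm
    filter_upwards [hφ, this] with ω h1 h2
    rw [h1, h2]; simp
  · set m := ∫ ω, φ ω ∂P
    let ψ : Lp ℝ 1 P := (hφi.const_mul m⁻¹).toL1 _
    have hψ : ψ =ᵐ[P] fun ω => m⁻¹ * φ ω := Integrable.coeFn_toL1 _
    have hmem : ψ ∈ densitySet P 𝒬 := by
      by_contra hψn
      -- If the normalised density `ψ` were outside, a separating functional `g` with level `u`
      -- would make `g - u` acceptable while `E[φ (g - u)] > 0`.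
      obtain ⟨Λ, u, hΛ1, hΛ2⟩ := geometric_hahn_banach_closed_point hconvex hclosed hψn
      obtain ⟨g, hg, hΛ⟩ := exists_bounded_integral_repr P Λ
      have hX : MemLp (fun ω => g ω - u) ∞ P := hg.sub (memLp_const u)
      have h := hpol _ hX fun Q hQ => by
        have := (h𝒬 Q hQ).1
        have hgQ := MemLp.integrable_of_absolutelyContinuous hg (h𝒬 Q hQ).2
        let q : Lp ℝ 1 P := (Measure.integrable_toReal_rnDeriv (μ := Q) (ν := P)).toL1 _
        have hq : q =ᵐ[P] fun ω => (Q.rnDeriv P ω).toReal := Integrable.coeFn_toL1 _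
        have h1 := hΛ1 q ⟨Q, hQ, hq⟩
        have h2 : Λ q = ∫ ω, g ω ∂Q := by
          rw [hΛ, integral_eq_integral_density_smul (h𝒬 Q hQ).2]
          apply integral_congr_ae
          filter_upwards [hq] with ω hω
          rw [hω, smul_eq_mul, mul_comm]
        rw [integral_sub hgQ (integrable_const _)]
        simp only [integral_const, probReal_univ, smul_eq_mul, one_mul]
        linarith
      have hgφ : Integrable (fun ω => φ ω * g ω) P := by
        obtain ⟨C, hC⟩ := MemLp.exists_ae_norm_le hg
        exact hφi.mul_bdd hg.1 hC
      have e : ∫ ω, φ ω * (g ω - u) ∂P = ∫ ω, φ ω * g ω ∂P - m * u := by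
        simp only [mul_sub]
        rw [integral_sub hgφ (hφi.mul_const u), integral_mul_const]
      have h3 : Λ ψ = m⁻¹ * ∫ ω, φ ω * g ω ∂P := by
        rw [hΛ, ← integral_const_mul]
        apply integral_congr_ae
        filter_upwards [hψ] with ω hω
        rw [hω]; ring
      rw [h3, lt_inv_mul_iff₀ hm] at hΛ2
      linarith
    obtain ⟨Q, hQ, hψQ⟩ := hmem
    refine ⟨m, hm.le, Q, hQ, ?_⟩
    filter_upwards [hφ, hψ, hψQ] with ω h1 h2 h3
    rw [h1, ← h3, h2, mul_inv_cancel_left₀ hm.ne']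

/-- With `sSup ∅ = 0` every bounded claim is acceptable, in particular `sign φ`, which gives `E|φ| ≤
0`. -/
theorem ae_eq_zero_of_mem_dualCone_empty
    (hV : IsNumeraireVector P V) {Z : Ω → EuclideanSpace ℝ (Fin (d + 1))}
    (hZ : Z ∈ dualCone P (attainingPortfolios P V (acceptanceSet P ∅))) : Z =ᵐ[P] 0 := by
  obtain ⟨φ, hφi, hφ⟩ := exists_eq_smul_of_mem_dualCone hV (by simp) hZ
  have hs : MemLp (fun ω => (SignType.sign (φ ω) : ℝ)) ∞ P := by
    refine memLp_top_of_bound ?_ 1 (.of_forall fun ω => ?_)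
    · have : Measurable fun x : ℝ => (SignType.sign x : ℝ) := by
        have : (fun x : ℝ => (SignType.sign x : ℝ)) =
            fun x => if 0 < x then 1 else if x < 0 then -1 else 0 := by
          ext x
          simp only [sign_apply]
          split_ifs <;> simp
        rw [this]
        exact Measurable.ite measurableSet_Ioi measurable_const
          (Measurable.ite measurableSet_Iio measurable_const measurable_const)
      exact (this.comp_aemeasurable hφi.1.aemeasurable).aestronglyMeasurable
    · rcases lt_trichotomy (φ ω) 0 with h | h | h <;> simp [h]
  have h := integral_mul_nonpos_of_smul_mem_dualCone hV (by simp) hZ hφ hs (by simp)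
  simp only [self_mul_sign] at h
  have h0 : φ =ᵐ[P] 0 := by
    have := (integral_eq_zero_iff_of_nonneg (fun ω => abs_nonneg (φ ω)) hφi.abs).1
      (le_antisymm h (integral_nonneg fun ω => abs_nonneg (φ ω)))
    filter_upwards [this] with ω hω using abs_eq_zero.1 hω
  filter_upwards [hφ, h0] with ω h1 h2
  rw [h1, h2]; simp

end DualCone

/-! ### Conditional expectations under measures agreeing on a sub-σ-algebra. -/

/-- An `m`-measurable function sees a measure only through its trace on `m`. -/
theorem integrable_of_measure_eq {Ω E : Type*} {m mΩ : MeasurableSpace Ω}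
    [NormedAddCommGroup E] (hm : m ≤ mΩ) {Q Q' : Measure Ω}
    (hQ : ∀ A, MeasurableSet[m] A → Q' A = Q A) {g : Ω → E} (hg : StronglyMeasurable[m] g)
    (hi : Integrable g Q') : Integrable g Q := by
  have h : Q'.trim hm = Q.trim hm := by
    refine @Measure.ext _ m _ _ fun A hA => ?_
    rw [trim_measurableSet_eq hm hA, trim_measurableSet_eq hm hA, hQ A hA]
  have := hi.trim hm hg
  rw [h] at this
  exact integrable_of_integrable_trim hm this

section ConditionalExpectation

variable {Ω : Type*} {m mΩ : MeasurableSpace Ω} {E : Type*} [NormedAddCommGroup E]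
  [NormedSpace ℝ E]

theorem setIntegral_eq_of_measure_eq (hm : m ≤ mΩ) {Q Q' : Measure Ω}
    (hQ : ∀ A, MeasurableSet[m] A → Q' A = Q A) {g : Ω → E} (hg : StronglyMeasurable[m] g)
    {A : Set Ω} (hA : MeasurableSet[m] A) : ∫ ω in A, g ω ∂Q' = ∫ ω in A, g ω ∂Q := by
  have h : Q'.trim hm = Q.trim hm := by
    refine @Measure.ext _ m _ _ fun A hA => ?_
    rw [trim_measurableSet_eq hm hA, trim_measurableSet_eq hm hA, hQ A hA]
  rw [setIntegral_trim hm hg hA, setIntegral_trim hm hg hA, h]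

/-- For two measures agreeing on `m`, the conditional expectations given `m` agree iff the
integrals over all `m`-measurable sets do. -/
theorem condExp_ae_eq_iff_of_measure_eq [CompleteSpace E] (hm : m ≤ mΩ) {Q Q' : Measure Ω}
    [IsFiniteMeasure Q] [IsFiniteMeasure Q'] (hQ : ∀ A, MeasurableSet[m] A → Q' A = Q A)
    {f : Ω → E} (hf : Integrable f Q) (hf' : Integrable f Q') :
    Q'[f | m] =ᵐ[Q] Q[f | m] ↔
      ∀ A, MeasurableSet[m] A → ∫ ω in A, f ω ∂Q' = ∫ ω in A, f ω ∂Q := by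
  have hkey : ∀ A, MeasurableSet[m] A → ∫ ω in A, (Q'[f | m]) ω ∂Q = ∫ ω in A, f ω ∂Q' := by
    intro A hA
    rw [← setIntegral_eq_of_measure_eq hm hQ stronglyMeasurable_condExp hA,
      setIntegral_condExp hm hf' hA]
  constructor
  · intro h A hA
    rw [← hkey A hA, ← setIntegral_condExp hm hf hA]
    exact integral_congr_ae (ae_restrict_of_ae h)
  · intro h
    refine ae_eq_condExp_of_forall_setIntegral_eq hm hf (fun s _ _ => ?_) (fun s hs _ => ?_)
      stronglyMeasurable_condExp.aestronglyMeasurable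
    · exact (integrable_of_measure_eq hm hQ stronglyMeasurable_condExp
        integrable_condExp).integrableOn
    · rw [hkey s hs, h s hs]

end ConditionalExpectation

theorem exists_measure_of_density {Ω : Type*} {mΩ : MeasurableSpace Ω} {P : Measure Ω}
    [IsFiniteMeasure P] {f : Ω → ℝ} (hf : Integrable f P) (hfm : Measurable f) (h0 : ∀ ω, 0 ≤ f ω) :
    ∃ Q : Measure Ω, IsFiniteMeasure Q ∧ Q ≪ P ∧ (fun ω => (Q.rnDeriv P ω).toReal) =ᵐ[P] f := by
  refine ⟨P.withDensity fun ω => ENNReal.ofReal (f ω), isFiniteMeasure_withDensity_ofReal hf.2,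
    withDensity_absolutelyContinuous _ _, ?_⟩
  filter_upwards [Measure.rnDeriv_withDensity P hfm.ennreal_ofReal] with ω hω
  rw [hω, ENNReal.toReal_ofReal (h0 ω)]

/-! ### From optional stability of the measures to stability of the cone. -/

section Pasting

variable {Ω : Type*} {mΩ : MeasurableSpace Ω} {P : Measure Ω} {T : ℕ} {ℱ : Filtration ℕ mΩ}
  {d : ℕ} {V : Ω → EuclideanSpace ℝ (Fin (d + 1))} {𝒬 : Set (Measure Ω)}

/-- An optionally `V`-m-stable set contains the measure obtained from `Q₁` by replacing its density
on `F ∈ ℱ_t` by an `ℱ_{t+1}`-measurable multiple of that of `Q₂`, provided that the conditional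
expectation given `ℱ_t` of the density times `V` is preserved. -/
theorem IsOptionallyMStable.exists_density_eq [IsProbabilityMeasure P]
    (hst : IsOptionallyMStable P ℱ T V 𝒬) (hV : IsNumeraireVector P V)
    (hunit : ∃ η : EuclideanSpace ℝ (Fin (d + 1)), ∀ᵐ ω ∂P, inner ℝ η (V ω) = 1)
    (h𝒬 : ∀ Q ∈ 𝒬, IsProbabilityMeasure Q ∧ Q ≪ P) {t : ℕ} (ht : t ≤ T) {F : Set Ω}
    (hF : MeasurableSet[ℱ t] F) {Q₁ Q₂ : Measure Ω} (hQ₁ : Q₁ ∈ 𝒬) (hQ₂ : Q₂ ∈ 𝒬) {γ : Ω → ℝ}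
    (hγm : Measurable[ℱ (min (t + 1) T)] γ) (hγ0 : ∀ ω, 0 ≤ γ ω)
    (hγi : Integrable (fun ω => γ ω * (Q₂.rnDeriv P ω).toReal) P)
    (heq : ∀ A, MeasurableSet[ℱ t] A → A ⊆ F →
      ∫ ω in A, (γ ω * (Q₂.rnDeriv P ω).toReal) • V ω ∂P =
        ∫ ω in A, (Q₁.rnDeriv P ω).toReal • V ω ∂P) :
    ∃ Q ∈ 𝒬, (fun ω => (Q.rnDeriv P ω).toReal) =ᵐ[P]
      F.indicator (fun ω => γ ω * (Q₂.rnDeriv P ω).toReal) +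
        Fᶜ.indicator (fun ω => (Q₁.rnDeriv P ω).toReal) := by
  classical
  obtain ⟨η, hη⟩ := hunit
  obtain ⟨hp1, hac1⟩ := h𝒬 Q₁ hQ₁
  obtain ⟨hp2, hac2⟩ := h𝒬 Q₂ hQ₂
  have hF' : MeasurableSet F := ℱ.le t F hF
  have hγm' : Measurable γ := hγm.mono (ℱ.le _) le_rfl
  have hq1m : Measurable fun ω => (Q₁.rnDeriv P ω).toReal :=
    (Measure.measurable_rnDeriv _ _).ennreal_toReal
  have hq2m : Measurable fun ω => (Q₂.rnDeriv P ω).toReal :=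
    (Measure.measurable_rnDeriv _ _).ennreal_toReal
  set f : Ω → ℝ := F.indicator (fun ω => γ ω * (Q₂.rnDeriv P ω).toReal) +
        Fᶜ.indicator (fun ω => (Q₁.rnDeriv P ω).toReal)
  have hfF : ∀ ω ∈ F, f ω = γ ω * (Q₂.rnDeriv P ω).toReal := fun ω hω => by simp [f, hω]
  have hfFc : ∀ ω ∉ F, f ω = (Q₁.rnDeriv P ω).toReal := fun ω hω => by simp [f, hω]
  have hfm : Measurable f := ((hγm'.mul hq2m).indicator hF').add (hq1m.indicator hF'.compl)
  have hfi : Integrable f P :=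
    (hγi.indicator hF').add (Measure.integrable_toReal_rnDeriv.indicator hF'.compl)
  have hf0 : ∀ ω, 0 ≤ f ω := fun ω => by
    by_cases hω : ω ∈ F
    · rw [hfF ω hω]; exact mul_nonneg (hγ0 ω) ENNReal.toReal_nonneg
    · rw [hfFc ω hω]; exact ENNReal.toReal_nonneg
  obtain ⟨Q, hQfin, hQac, hQf⟩ := exists_measure_of_density hfi hfm hf0
  refine ⟨Q, ?_, hQf⟩
  -- Stopping at `T` off `F` leaves the density of `Q₁` untouched there.
  let τ : Ω → WithTop ℕ := F.piecewise (fun _ => (t : WithTop ℕ)) (fun _ => (T : WithTop ℕ))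
  have hτ : IsStoppingTime ℱ τ := isStoppingTime_piecewise_const ht hF
  have hτF : ∀ ω ∈ F, τ ω = t := fun ω hω => by simp [τ, hω]
  have hτFc : ∀ ω ∉ F, τ ω = T := fun ω hω => by simp [τ, hω]
  have hτle : ∀ ω, τ ω ≤ T := fun ω => by
    by_cases hω : ω ∈ F
    · rw [hτF ω hω]; exact_mod_cast ht
    · rw [hτFc ω hω]
  have hlt : ∀ ω, τ ω < T → ω ∈ F ∧ t < T := fun ω h => by
    by_cases hω : ω ∈ F
    · rw [hτF ω hω] at h; exact ⟨hω, by exact_mod_cast h⟩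
    · rw [hτFc ω hω] at h; exact absurd h (lt_irrefl _)
  have hmτ : hτ.measurableSpace ≤ mΩ := hτ.measurableSpace_le
  have hτset : ∀ A, MeasurableSet[hτ.measurableSpace] A → MeasurableSet[ℱ t] (A ∩ F) := by
    intro A hA
    have h := (hA.2 t).inter hF
    convert h using 1
    ext ω
    constructor
    · rintro ⟨h1, h2⟩
      exact ⟨⟨h1, (hτF ω h2).le⟩, h2⟩
    · rintro ⟨⟨h1, _⟩, h2⟩
      exact ⟨h1, h2⟩
  have hsetQ : ∀ {E : Type _} [NormedAddCommGroup E] [NormedSpace ℝ E] (X : Ω → E) {A : Set Ω},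
      MeasurableSet A → ∫ ω in A, X ω ∂Q = ∫ ω in A, f ω • X ω ∂P := by
    intro E _ _ X A hA
    rw [← setIntegral_rnDeriv_smul hQac hA]
    apply integral_congr_ae
    filter_upwards [ae_restrict_of_ae hQf] with ω hω
    rw [hω]
  have hfV := hV.integrable_smul hfi
  have hq1V := hV.integrable_smul (Measure.integrable_toReal_rnDeriv (μ := Q₁) (ν := P))
  have hVA' : ∀ A, MeasurableSet[hτ.measurableSpace] A →
      ∫ ω in A, f ω • V ω ∂P = ∫ ω in A, (Q₁.rnDeriv P ω).toReal • V ω ∂P := by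
    intro A hA
    have hA' := hmτ A hA
    rw [← integral_inter_add_sdiff hF' hfV.integrableOn,
      ← integral_inter_add_sdiff hF' hq1V.integrableOn, ← heq _ (hτset A hA) Set.inter_subset_right]
    congr 1
    · exact setIntegral_congr_fun (hA'.inter hF') fun ω hω => by simp only [hfF ω hω.2]
    · exact setIntegral_congr_fun (hA'.diff hF') fun ω hω => by simp only [hfFc ω hω.2]
  have hVA : ∀ A, MeasurableSet[hτ.measurableSpace] A → ∫ ω in A, V ω ∂Q = ∫ ω in A, V ω ∂Q₁ := by
    intro A hA
    rw [hsetQ V (hmτ A hA), hVA' A hA, setIntegral_rnDeriv_smul hac1 (hmτ A hA)]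
  have hagree : ∀ A, MeasurableSet[hτ.measurableSpace] A → Q A = Q₁ A := by
    intro A hA
    -- Since `η · V = 1`, pairing the vector identity with `η` turns integrals of `V` over `A` into
    -- the measures of `A`.
    have h := congrArg (fun x => inner ℝ η x) (hVA A hA)
    have key : ∀ ν : Measure Ω, IsFiniteMeasure ν → ν ≪ P →
        inner ℝ η (∫ ω in A, V ω ∂ν) = ν.real A := by
      intro ν _ hR
      rw [← integral_inner (hV.integrable hR).integrableOn,
        integral_congr_ae (ae_restrict_of_ae (hR.ae_le hη))]
      simp
    rw [key Q hQfin hQac, key Q₁ inferInstance hac1] at h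
    exact (measureReal_eq_measureReal_iff).1 h
  have hQp : IsProbabilityMeasure Q := ⟨by rw [hagree _ MeasurableSet.univ, measure_univ]⟩
  have hsetF : ∀ (X : Ω → ℝ) {A : Set Ω}, MeasurableSet A → A ⊆ F →
      ∫ ω in A, X ω ∂Q = ∫ ω in A, γ ω * X ω ∂Q₂ := by
    intro X A hA hAF
    rw [hsetQ X hA, ← setIntegral_rnDeriv_smul hac2 hA]
    refine setIntegral_congr_fun hA fun ω hω => ?_
    simp only [hfF ω (hAF hω), smul_eq_mul]
    ring
  refine hst τ hτ hτle Q₁ hQ₁ Q₂ hQ₂ Q ⟨hQp, hQac, hagree, ?_, ?_⟩ ?_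
  · intro B hB hBs hB0
    have hB' : MeasurableSet B := IsStoppingTime.measurableSpace_le _ B hB
    have h := hsetF (fun _ => 1) hB' fun ω hω => (hlt ω (hBs hω)).1
    rw [Measure.restrict_eq_zero.2 hB0] at h
    simpa [measureReal_eq_zero_iff] using h
  · intro A hA
    have hG : nextSigma T hτ ≤ mΩ := IsStoppingTime.measurableSpace_le _
    by_cases htT : t < T
    swap
    · exact .of_forall fun ω h => absurd (hlt ω h).2 htT
    -- As `t < T`, the time `(τ+1) ∧ T` is at least `t + 1` everywhere, also off `F`.
    have hle : ℱ (t + 1) ≤ nextSigma T hτ := by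
      apply IsStoppingTime.le_measurableSpace_of_const_le
      intro ω
      have h1 : ((t + 1 : ℕ) : WithTop ℕ) ≤ τ ω + (1 : ℕ) := by
        by_cases hω : ω ∈ F
        · rw [hτF ω hω]; norm_cast
        · rw [hτFc ω hω]; norm_cast; omega
      exact le_min h1 (by exact_mod_cast htT)
    have hFG : MeasurableSet[nextSigma T hτ] F := hle _ (ℱ.mono (Nat.le_succ t) F hF)
    have hγG : Measurable[nextSigma T hτ] γ := by
      rw [min_eq_left (Nat.succ_le_of_lt htT)] at hγm
      exact hγm.mono hle le_rfl
    set I : Ω → ℝ := A.indicator fun _ => (1 : ℝ)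
    have hIi : ∀ ν : Measure Ω, IsFiniteMeasure ν → Integrable I ν := fun ν _ =>
      (integrable_const 1).indicator hA
    have hγ2 : Integrable γ Q₂ := by
      rw [← integrable_rnDeriv_smul_iff hac2]
      exact hγi.congr (.of_forall fun ω => mul_comm _ _)
    have hγI : Integrable (γ * I) Q₂ := by
      refine hγ2.mul_bdd (c := 1) (hIi Q₂ inferInstance).1 (.of_forall fun ω => ?_)
      by_cases hω : ω ∈ A <;> simp [I, hω]
    have hpull := condExp_mul_of_stronglyMeasurable_left (m := nextSigma T hτ)
      hγG.stronglyMeasurable hγI (hIi Q₂ inferInstance)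
    set h2 := Q₂[I | nextSigma T hτ]
    set hQ := Q[I | nextSigma T hτ] with hhQ
    -- On `F` the factor `γ` is measurable for the conditioning σ-algebra and pulls out, so the
    -- conditional probability is that of `Q₂`; off `F` nothing is claimed beyond `Q` itself.
    have hpaste : F.indicator h2 + Fᶜ.indicator hQ =ᵐ[Q] Q[I | nextSigma T hτ] := by
      have hsF : Integrable (F.indicator h2) Q := by
        rw [← integrable_rnDeriv_smul_iff hQac]
        have h4 : Integrable (fun ω => (Q₂.rnDeriv P ω).toReal • (γ * h2) ω) P := by
          rw [integrable_rnDeriv_smul_iff hac2]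
          exact integrable_condExp.congr hpull
        refine (h4.indicator hF').congr ?_
        filter_upwards [hQf] with ω hω
        rw [hω]
        by_cases hωF : ω ∈ F
        · simp only [hωF, Set.indicator_of_mem, hfF ω hωF, smul_eq_mul, Pi.mul_apply]; ring
        · simp [hωF]
      have hsFc : Integrable (Fᶜ.indicator hQ) Q := integrable_condExp.indicator hF'.compl
      refine ae_eq_condExp_of_forall_setIntegral_eq hG (hIi Q inferInstance)
        (fun s _ _ => (hsF.add hsFc).integrableOn) (fun s hs _ => ?_) ?_
      · have hs' := hG s hs
        rw [← integral_inter_add_sdiff hF' (hsF.add hsFc).integrableOn,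
          ← integral_inter_add_sdiff hF' (hIi Q inferInstance).integrableOn]
        congr 1
        · rw [hsetF _ (hs'.inter hF') Set.inter_subset_right,
            hsetF _ (hs'.inter hF') Set.inter_subset_right]
          rw [setIntegral_congr_fun (g := γ * h2) (hs'.inter hF')
            fun ω hω => by simp [hω.2]]
          rw [← integral_congr_ae (ae_restrict_of_ae hpull),
            setIntegral_condExp hG hγI (hs.inter hFG)]
          rfl
        · rw [← setIntegral_condExp hG (hIi Q inferInstance) (hs.diff hFG)]
          exact setIntegral_congr_fun (hs'.diff hF') fun ω hω => by simp [hω.2, hhQ]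
      · exact ((stronglyMeasurable_condExp.indicator hFG).add
          (stronglyMeasurable_condExp.indicator hFG.compl)).aestronglyMeasurable
    filter_upwards [hpaste] with ω hω hωτ
    exact hω.symm.trans (by simp [(hlt ω hωτ).1])
  · exact (condExp_ae_eq_iff_of_measure_eq hmτ hagree (hV.integrable hac1)
      (hV.integrable hQac)).2 hVA

/-- Optional `V`-m-stability of `𝒬` makes the dual cone stable under pasting. -/
theorem IsOptionallyMStable.isPastingStable [IsProbabilityMeasure P]
    (hst : IsOptionallyMStable P ℱ T V 𝒬) (hV : IsNumeraireVector P V)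
    (hunit : ∃ η : EuclideanSpace ℝ (Fin (d + 1)), ∀ᵐ ω ∂P, inner ℝ η (V ω) = 1)
    (h𝒬 : ∀ Q ∈ 𝒬, IsProbabilityMeasure Q ∧ Q ≪ P) (hne : 𝒬.Nonempty)
    (hconvex : Convex ℝ (densitySet P 𝒬)) (hclosed : IsClosed (densitySet P 𝒬)) :
    IsPastingStable P ℱ T (dualCone P (attainingPortfolios P V (acceptanceSet P 𝒬))) := by
  intro t ht Y hY W hW Z hZ F hF α β hα hβ hα0 hβ0 hαi hβi hcond
  obtain ⟨y, hy, QY, hQY, hYe⟩ :=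
    exists_eq_smul_density_of_mem_dualCone hV hne h𝒬 hconvex hclosed hY
  obtain ⟨w, hw, QW, hQW, hWe⟩ :=
    exists_eq_smul_density_of_mem_dualCone hV hne h𝒬 hconvex hclosed hW
  obtain ⟨z, hz, QZ, hQZ, hZe⟩ :=
    exists_eq_smul_density_of_mem_dualCone hV hne h𝒬 hconvex hclosed hZ
  have hF' : MeasurableSet F := ℱ.le t F hF
  set X := F.indicator (fun ω => α ω • Y ω) + Fᶜ.indicator (fun ω => β ω • W ω) with hX
  have hXi : Integrable X P := (hαi.indicator hF').add (hβi.indicator hF'.compl)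
  have hXZ : ∀ A, MeasurableSet[ℱ t] A → ∫ ω in A, X ω ∂P = ∫ ω in A, Z ω ∂P := by
    intro A hA
    rw [← setIntegral_condExp (ℱ.le t) hXi hA, ← setIntegral_condExp (ℱ.le t) hZ.1 hA]
    exact integral_congr_ae (ae_restrict_of_ae hcond)
  let a : Ω → ℝ := fun ω => α ω * y * (QY.rnDeriv P ω).toReal
  let b : Ω → ℝ := fun ω => β ω * w * (QW.rnDeriv P ω).toReal
  have ha0 : ∀ ω, 0 ≤ a ω := fun ω => mul_nonneg (mul_nonneg (hα0 ω) hy) ENNReal.toReal_nonneg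
  have hb0 : ∀ ω, 0 ≤ b ω := fun ω => mul_nonneg (mul_nonneg (hβ0 ω) hw) ENNReal.toReal_nonneg
  have haV : (fun ω => α ω • Y ω) =ᵐ[P] fun ω => a ω • V ω := by
    filter_upwards [hYe] with ω hω
    rw [hω, smul_smul]; simp only [a, mul_assoc]
  have hbV : (fun ω => β ω • W ω) =ᵐ[P] fun ω => b ω • V ω := by
    filter_upwards [hWe] with ω hω
    rw [hω, smul_smul]; simp only [b, mul_assoc]
  have hai : Integrable a P := integrable_of_integrable_smul hV (hαi.congr haV)
  have hbi : Integrable b P := integrable_of_integrable_smul hV (hβi.congr hbV)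
  have hXe : X =ᵐ[P] fun ω => (F.indicator a ω + Fᶜ.indicator b ω) • V ω := by
    filter_upwards [haV, hbV] with ω h1 h2
    by_cases hω : ω ∈ F
    · simpa [X, hω] using h1
    · simpa [X, hω] using h2
  -- If `z = 0`, then `E[X] = 0`. Pairing with `η` gives integral zero for the nonnegative
  -- coefficient of `V` in `X`, so `X = 0`.
  rcases hz.eq_or_lt with hz0 | hzpos
  · obtain ⟨η, hη⟩ := hunit
    have hgi : Integrable (fun ω => F.indicator a ω + Fᶜ.indicator b ω) P :=
      (hai.indicator hF').add (hbi.indicator hF'.compl)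
    have hg0 : 0 ≤ fun ω => F.indicator a ω + Fᶜ.indicator b ω := fun ω =>
      add_nonneg (Set.indicator_nonneg (fun ω _ => ha0 ω) ω)
        (Set.indicator_nonneg (fun ω _ => hb0 ω) ω)
    have h1 : ∫ ω, X ω ∂P = 0 := by
      rw [← setIntegral_univ, hXZ _ MeasurableSet.univ, setIntegral_univ]
      refine integral_eq_zero_of_ae ?_
      filter_upwards [hZe] with ω hω
      rw [hω, ← hz0]; simp
    have h2 : ∫ ω, (F.indicator a ω + Fᶜ.indicator b ω) ∂P = 0 := by
      have h3 := integral_inner (𝕜 := ℝ) hXi η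
      rw [h1, inner_zero_right] at h3
      rw [← h3]
      apply integral_congr_ae
      filter_upwards [hXe, hη] with ω h4 h5
      rw [h4, real_inner_smul_right, h5, mul_one]
    have h6 := (integral_eq_zero_iff_of_nonneg hg0 hgi).1 h2
    refine smul_density_mem_dualCone hV h𝒬 hQZ le_rfl ?_
    filter_upwards [hXe, h6] with ω h4 h5
    rw [h4, h5]; simp
  · have hmul : ∀ (e : Ω → ℝ) (U : Ω → EuclideanSpace ℝ (Fin (d + 1))),
        U =ᵐ[P] (fun ω => e ω • V ω) → ∀ A, MeasurableSet[ℱ t] A → (∀ ω ∈ A, X ω = U ω) →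
        ∫ ω in A, (z⁻¹ * e ω) • V ω ∂P = ∫ ω in A, (QZ.rnDeriv P ω).toReal • V ω ∂P := by
      intro e U hU A hA hXU
      have h1 : ∫ ω in A, X ω ∂P = ∫ ω in A, e ω • V ω ∂P := by
        rw [setIntegral_congr_fun (ℱ.le t A hA) hXU]
        exact integral_congr_ae (ae_restrict_of_ae hU)
      have h2 : ∫ ω in A, Z ω ∂P = z • ∫ ω in A, (QZ.rnDeriv P ω).toReal • V ω ∂P := by
        rw [← integral_smul]
        apply integral_congr_ae
        filter_upwards [ae_restrict_of_ae hZe] with ω hω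
        rw [hω, smul_smul]
      simp only [mul_smul]
      rw [integral_smul, ← h1, hXZ A hA, h2, smul_smul, inv_mul_cancel₀ hzpos.ne', one_smul]
    have eA : ∀ ω, z⁻¹ * (α ω * y) * (QY.rnDeriv P ω).toReal = z⁻¹ * a ω := fun ω => by
      simp only [a]; ring
    have eB : ∀ ω, z⁻¹ * (β ω * w) * (QW.rnDeriv P ω).toReal = z⁻¹ * b ω := fun ω => by
      simp only [b]; ring
    obtain ⟨Q', hQ', hQ'e⟩ := hst.exists_density_eq hV hunit h𝒬 ht hF hQZ hQY
      (γ := fun ω => z⁻¹ * (α ω * y)) ((hα.mul_const y).const_mul _)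
      (fun ω => mul_nonneg (inv_nonneg.2 hz) (mul_nonneg (hα0 ω) hy))
      (by simpa only [eA] using hai.const_mul z⁻¹)
      (fun A hA hAF => by
        simp only [eA]
        exact hmul a _ haV A hA fun ω hω => by simp [X, hAF hω])
    -- The second pasting starts from `Q'`, whose density on `Fᶜ` is still that of `QZ`, so the
    -- condition on `Fᶜ` is again the one inherited from `Z`.
    obtain ⟨Q'', hQ'', hQ''e⟩ := hst.exists_density_eq hV hunit h𝒬 ht hF.compl hQ' hQW
      (γ := fun ω => z⁻¹ * (β ω * w)) ((hβ.mul_const w).const_mul _)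
      (fun ω => mul_nonneg (inv_nonneg.2 hz) (mul_nonneg (hβ0 ω) hw))
      (by simpa only [eB] using hbi.const_mul z⁻¹)
      (fun A hA hAF => by
        simp only [eB]
        rw [hmul b _ hbV A hA fun ω hω => by simp [X, show ω ∉ F from hAF hω]]
        apply setIntegral_congr_ae (ℱ.le t A hA)
        filter_upwards [hQ'e] with ω h1 hω
        rw [h1]
        simp [show ω ∉ F from hAF hω])
    refine smul_density_mem_dualCone hV h𝒬 hQ'' hz ?_
    filter_upwards [hXe, hQ'e, hQ''e] with ω h1 h2 h3
    rw [h1, h3]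
    congr 1
    by_cases hω : ω ∈ F
    · simp only [Pi.add_apply, compl_compl, Set.mem_compl_iff, hω, not_true_eq_false,
        not_false_eq_true, Set.indicator_of_mem, Set.indicator_of_notMem, h2, eA]
      field_simp
      ring
    · simp only [Pi.add_apply, compl_compl, Set.mem_compl_iff, hω,
        not_false_eq_true, Set.indicator_of_mem, Set.indicator_of_notMem, eB]
      field_simp
      ring

end Pasting

/-! ### From stability of the cone to optional stability of the measures. -/

/-- The defining property of the conditional probability, tested against nonnegative functions. -/
theorem lintegral_mul_ofReal_condExp_indicator {Ω : Type*} {m mΩ : MeasurableSpace Ω} (hm : m ≤ mΩ)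
    {Q : Measure Ω} [IsFiniteMeasure Q] {A : Set Ω} (hA : MeasurableSet A) {u : Ω → ℝ≥0∞}
    (hu : Measurable[m] u) :
    ∫⁻ ω, ENNReal.ofReal ((Q[A.indicator (fun _ => (1 : ℝ)) | m]) ω) * u ω ∂Q =
      ∫⁻ ω in A, u ω ∂Q := by
  set g : Ω → ℝ≥0∞ := fun ω => ENNReal.ofReal ((Q[A.indicator (fun _ => (1 : ℝ)) | m]) ω) with hg
  have hgm : Measurable[m] g := stronglyMeasurable_condExp.measurable.ennreal_ofReal
  have hAi : Integrable (A.indicator fun _ => (1 : ℝ)) Q := (integrable_const 1).indicator hA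
  have htrim : (Q.withDensity g).trim hm = (Q.restrict A).trim hm := by
    refine @Measure.ext _ m _ _ fun B hB => ?_
    have hB' := hm B hB
    rw [trim_measurableSet_eq hm hB, trim_measurableSet_eq hm hB, withDensity_apply _ hB',
      Measure.restrict_apply hB', hg,
      ← ofReal_integral_eq_lintegral_ofReal integrable_condExp.integrableOn
        (ae_restrict_of_ae (condExp_nonneg (.of_forall fun ω =>
          Set.indicator_nonneg (fun _ _ => zero_le_one) ω))),
      setIntegral_condExp hm hAi hB, setIntegral_indicator hA]
    simp
  calc ∫⁻ ω, g ω * u ω ∂Q = ∫⁻ ω, u ω ∂(Q.withDensity g) :=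
        (lintegral_withDensity_eq_lintegral_mul _ (hgm.mono hm le_rfl) (hu.mono hm le_rfl)).symm
    _ = ∫⁻ ω in A, u ω ∂Q := by rw [← lintegral_trim hm hu, htrim, lintegral_trim hm hu]

theorem condExp_ae_eq_condExp_of_forall_setIntegral_eq {Ω E : Type*} {m mΩ : MeasurableSpace Ω}
    [NormedAddCommGroup E] [NormedSpace ℝ E] [CompleteSpace E] (hm : m ≤ mΩ) {P : Measure Ω}
    [IsFiniteMeasure P] {f g : Ω → E} (hf : Integrable f P) (hg : Integrable g P)
    (h : ∀ A, MeasurableSet[m] A → ∫ ω in A, f ω ∂P = ∫ ω in A, g ω ∂P) :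
    P[f | m] =ᵐ[P] P[g | m] :=
  ae_eq_condExp_of_forall_setIntegral_eq hm hg (fun _ _ _ => integrable_condExp.integrableOn)
    (fun s hs _ => by rw [setIntegral_condExp hm hf hs, h s hs])
    stronglyMeasurable_condExp.aestronglyMeasurable

theorem rnDeriv_ae_eq_restrict_of_measure_eq {Ω : Type*} {mΩ : MeasurableSpace Ω} {P : Measure Ω}
    [IsFiniteMeasure P] {Q : Measure Ω} [IsFiniteMeasure Q] (hQ : Q ≪ P)
    {S : Set Ω} {f : Ω → ℝ≥0∞} (hf : Measurable f)
    (h : ∀ A, MeasurableSet A → Q (A ∩ S) = ∫⁻ ω in A ∩ S, f ω ∂P) :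
    Q.rnDeriv P =ᵐ[P.restrict S] f := by
  refine ae_eq_of_forall_setLIntegral_eq_of_sigmaFinite (Measure.measurable_rnDeriv _ _) hf
    fun A hA _ => ?_
  rw [Measure.restrict_restrict hA, Measure.setLIntegral_rnDeriv hQ, h A hA]

theorem measure_eq_of_density_ae_eq {Ω : Type*} {mΩ : MeasurableSpace Ω} {P : Measure Ω}
    [IsFiniteMeasure P] {Q Q' : Measure Ω} [IsFiniteMeasure Q] [IsFiniteMeasure Q'] (hQ : Q ≪ P)
    (hQ' : Q' ≪ P)
    (h : (fun ω => (Q.rnDeriv P ω).toReal) =ᵐ[P] fun ω => (Q'.rnDeriv P ω).toReal) : Q = Q' := by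
  ext A _
  rw [← measureReal_eq_measureReal_iff, ← Measure.setIntegral_toReal_rnDeriv hQ,
    ← Measure.setIntegral_toReal_rnDeriv hQ']
  exact integral_congr_ae (ae_restrict_of_ae h)

theorem dualCone_congr {Ω : Type*} {mΩ : MeasurableSpace Ω} {P : Measure Ω} {d : ℕ}
    {B : Set (Ω → EuclideanSpace ℝ (Fin (d + 1)))} {Z Z' : Ω → EuclideanSpace ℝ (Fin (d + 1))}
    (hZ : Z ∈ dualCone P B) (h : Z =ᵐ[P] Z') : Z' ∈ dualCone P B := by
  refine ⟨hZ.1.congr h, fun Y hY => le_of_eq_of_le (integral_congr_ae ?_) (hZ.2 Y hY)⟩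
  filter_upwards [h] with ω hω
  rw [hω]

section Pasting

variable {Ω : Type*} {mΩ : MeasurableSpace Ω} {P : Measure Ω} {T : ℕ} {ℱ : Filtration ℕ mΩ}
  {d : ℕ} {V : Ω → EuclideanSpace ℝ (Fin (d + 1))} {𝒬 : Set (Measure Ω)}
  {τ : Ω → WithTop ℕ} {hτ : IsStoppingTime ℱ τ} {Q₁ Q₂ Q' : Measure Ω}

/-- Before `T`, an optional pasting has an `ℱ_{(τ+1) ∧ T}`-measurable density with respect to
`Q₂`. -/
theorem IsOptionalPasting.exists_density [IsFiniteMeasure Q₂]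
    (h : IsOptionalPasting P T hτ Q₁ Q₂ Q') (hτT : ∀ ω, τ ω ≤ T) :
    ∃ γ : Ω → ℝ≥0∞, Measurable[nextSigma T hτ] γ ∧ ∀ A, MeasurableSet A →
      Q' (A ∩ {ω | τ ω < T}) = ∫⁻ ω in A ∩ {ω | τ ω < T}, γ ω ∂Q₂ := by
  have hQ' := h.isProbabilityMeasure
  have hG : nextSigma T hτ ≤ mΩ := IsStoppingTime.measurableSpace_le _
  set S : Set Ω := {ω | τ ω < T}
  have hSG : MeasurableSet[nextSigma T hτ] S := by
    refine IsStoppingTime.measurableSpace_mono hτ _ (fun ω => ?_) S (hτ.measurableSet_lt' T)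
    exact le_min le_self_add (hτT ω)
  have hSm : MeasurableSet S := hG S hSG
  let μ' := (Q'.restrict S).trim hG
  let μ₂ := (Q₂.restrict S).trim hG
  -- This is exactly the `null` clause of the pasting; it lets `γ` be a Radon–Nikodym derivative on
  -- the σ-algebra at `(τ+1) ∧ T`.
  have hac : μ' ≪ μ₂ := by
    refine @Measure.AbsolutelyContinuous.mk _ (nextSigma T hτ) _ _ fun B hB hB0 => ?_
    rw [trim_measurableSet_eq hG hB, Measure.restrict_apply (hG B hB)] at hB0 ⊢
    exact h.null _ (hB.inter hSG) Set.inter_subset_right hB0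
  let γ : Ω → ℝ≥0∞ := μ'.rnDeriv μ₂
  have hγ : Measurable[nextSigma T hτ] γ := Measure.measurable_rnDeriv _ _
  have hint : ∀ g : Ω → ℝ≥0∞, Measurable[nextSigma T hτ] g →
      ∫⁻ ω in S, g ω ∂Q' = ∫⁻ ω in S, γ ω * g ω ∂Q₂ := by
    intro g hg
    have h1 := lintegral_trim hG (μ := Q₂.restrict S) (hγ.mul hg)
    rw [← lintegral_trim hG hg]
    exact (lintegral_rnDeriv_mul hac hg.aemeasurable).symm.trans h1
  refine ⟨γ, hγ, fun A hA => ?_⟩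
  let I : Ω → ℝ := A.indicator fun _ => 1
  let g : Ω → ℝ≥0∞ := fun ω => ENNReal.ofReal ((Q₂[I | nextSigma T hτ]) ω)
  have hg : Measurable[nextSigma T hτ] g := stronglyMeasurable_condExp.measurable.ennreal_ofReal
  -- The conditional probabilities extend the density identity from the σ-algebra at `(τ+1) ∧ T` to
  -- every event `A`.
  have h1 : ∫⁻ ω in S, g ω ∂Q' = Q' (A ∩ S) := by
    have h2 := lintegral_mul_ofReal_condExp_indicator hG (Q := Q') hA
      (u := S.indicator 1) (Measurable.indicator measurable_const hSG)
    rw [lintegral_indicator_one₀ hSm.nullMeasurableSet, Measure.restrict_apply hSm,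
      Set.inter_comm] at h2
    rw [← h2, ← lintegral_indicator hSm]
    apply lintegral_congr_ae
    filter_upwards [h.condProb A hA] with ω hω
    by_cases hωS : ω ∈ S
    · simp only [hωS, Set.indicator_of_mem, Pi.one_apply, mul_one, g]
      rw [hω hωS]
    · simp [hωS]
  have h3 := lintegral_mul_ofReal_condExp_indicator hG (Q := Q₂) hA
    (u := S.indicator γ) (hγ.indicator hSG)
  rw [lintegral_indicator hSm, Measure.restrict_restrict hSm, Set.inter_comm] at h3
  rw [← h1, hint g hg, ← h3, ← lintegral_indicator hSm]
  apply lintegral_congr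
  intro ω
  by_cases hωS : ω ∈ S
  · simp [hωS, g, I, mul_comm]
  · simp [hωS]

/-- On `{τ = t}` the time `(τ+1) ∧ T` is at most `t + 1`, so events known then lie in `ℱ_{t+1}` once
cut down to this set. -/
theorem measurable_indicator_of_nextSigma (hτ : IsStoppingTime ℱ τ) {t : ℕ} (ht : t < T)
    {γ : Ω → ℝ} (hγ : Measurable[nextSigma T hτ] γ) :
    Measurable[ℱ (min (t + 1) T)] ({ω | τ ω = t}.indicator γ) := by
  rw [min_eq_left (Nat.succ_le_of_lt ht)]
  have hS : MeasurableSet[ℱ (t + 1)] {ω | τ ω = t} :=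
    ℱ.mono (Nat.le_succ t) _ (hτ.measurableSet_eq t)
  intro B hB
  rw [Set.indicator_preimage, Set.ite]
  refine MeasurableSet.union ?_ ((measurable_const hB).diff hS)
  have h := ((hγ hB).2 (t + 1)).inter hS
  convert h using 1
  ext ω
  simp only [Set.mem_inter_iff, Set.mem_ofPred_eq]
  constructor
  · rintro ⟨h1, h2⟩
    refine ⟨⟨h1, ?_⟩, h2⟩
    rw [h2]
    exact min_le_left _ _
  · rintro ⟨⟨h1, _⟩, h2⟩
    exact ⟨h1, h2⟩

/-- Before `T`, the density of an optional pasting is an `ℱ_{(τ+1) ∧ T}`-measurable multiple of that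
of `Q₂`. -/
theorem IsOptionalPasting.exists_density_eq_mul [IsFiniteMeasure P] [IsFiniteMeasure Q₂]
    (h : IsOptionalPasting P T hτ Q₁ Q₂ Q') (hτT : ∀ ω, τ ω ≤ T) (hQ₂ : Q₂ ≪ P) :
    ∃ γ : Ω → ℝ, Measurable[nextSigma T hτ] γ ∧ (∀ ω, 0 ≤ γ ω) ∧ ∀ᵐ ω ∂P, τ ω < T →
      (Q'.rnDeriv P ω).toReal = γ ω * (Q₂.rnDeriv P ω).toReal := by
  have hQ' := h.isProbabilityMeasure
  have hG : nextSigma T hτ ≤ mΩ := IsStoppingTime.measurableSpace_le _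
  obtain ⟨γ, hγ, hA⟩ := h.exists_density hτT
  have hγ' : Measurable γ := hγ.mono hG le_rfl
  have hS : MeasurableSet {ω | τ ω < T} :=
    hτ.measurableSpace_le _ (hτ.measurableSet_lt' T)
  refine ⟨fun ω => (γ ω).toReal, hγ.ennreal_toReal, fun ω => ENNReal.toReal_nonneg, ?_⟩
  have h1 : Q'.rnDeriv P =ᵐ[P.restrict {ω | τ ω < T}] fun ω => Q₂.rnDeriv P ω * γ ω := by
    refine rnDeriv_ae_eq_restrict_of_measure_eq h.absolutelyContinuous
      ((Measure.measurable_rnDeriv _ _).mul hγ') fun A hAm => ?_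
    rw [hA A hAm, setLIntegral_rnDeriv_mul hQ₂ hγ'.aemeasurable (hAm.inter hS)]
  rw [Filter.EventuallyEq, ae_restrict_iff' hS] at h1
  filter_upwards [h1] with ω hω hωτ
  rw [hω hωτ, ENNReal.toReal_mul, mul_comm]

/-- Because `ℱ_T` is everything, each `A ∩ {τ = T}` belongs to `ℱ_τ`, where `Q'` and `Q₁` agree. -/
theorem IsOptionalPasting.density_eq_at_horizon [IsFiniteMeasure P] [IsFiniteMeasure Q₁]
    (h : IsOptionalPasting P T hτ Q₁ Q₂ Q') (hℱ : ℱ T = mΩ) (hQ₁ : Q₁ ≪ P) :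
    ∀ᵐ ω ∂P, τ ω = T → Q'.rnDeriv P ω = Q₁.rnDeriv P ω := by
  have hQ' := h.isProbabilityMeasure
  have hS : MeasurableSet {ω | τ ω = T} := ℱ.le T _ (hτ.measurableSet_eq T)
  have h1 : Q'.rnDeriv P =ᵐ[P.restrict {ω | τ ω = T}] Q₁.rnDeriv P := by
    refine rnDeriv_ae_eq_restrict_of_measure_eq h.absolutelyContinuous
      (Measure.measurable_rnDeriv _ _) fun A hA => ?_
    rw [Measure.setLIntegral_rnDeriv hQ₁]
    apply h.agree
    exact (hτ.measurableSet_inter_eq_iff A T).2 (by rw [hℱ]; exact hA.inter hS)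
  rwa [Filter.EventuallyEq, ae_restrict_iff' hS] at h1

/-- Stability of the dual cone under pasting makes `𝒬` optionally `V`-m-stable. -/
theorem IsPastingStable.isOptionallyMStable [IsProbabilityMeasure P]
    (hst : IsPastingStable P ℱ T (dualCone P (attainingPortfolios P V (acceptanceSet P 𝒬))))
    (hℱ : ℱ T = mΩ) (hV : IsNumeraireVector P V)
    (h𝒬 : ∀ Q ∈ 𝒬, IsProbabilityMeasure Q ∧ Q ≪ P)
    (hconvex : Convex ℝ (densitySet P 𝒬)) (hclosed : IsClosed (densitySet P 𝒬)) :
    IsOptionallyMStable P ℱ T V 𝒬 := by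
  intro τ hτ hτT Q₁ hQ₁ Q₂ hQ₂ Q' hpast hcond
  obtain ⟨hp1, hac1⟩ := h𝒬 Q₁ hQ₁
  obtain ⟨hp2, hac2⟩ := h𝒬 Q₂ hQ₂
  have hp' := hpast.isProbabilityMeasure
  have hac' := hpast.absolutelyContinuous
  set D := dualCone P (attainingPortfolios P V (acceptanceSet P 𝒬))
  have hmτ : hτ.measurableSpace ≤ mΩ := hτ.measurableSpace_le
  have hVeq := (condExp_ae_eq_iff_of_measure_eq hmτ hpast.agree (hV.integrable hac1)
    (hV.integrable hac')).1 hcond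
  obtain ⟨γ, hγ, hγ0, hγe⟩ := hpast.exists_density_eq_mul hτT hac2
  have hfin := hpast.density_eq_at_horizon hℱ hac1
  have hdens : ∀ Q ∈ 𝒬, (fun ω => (Q.rnDeriv P ω).toReal • V ω) ∈ D := fun Q hQ =>
    smul_density_mem_dualCone hV h𝒬 hQ zero_le_one (.of_forall fun ω => by simp)
  -- `q k` interpolates between the density of `Q₁` at `k = 0` and that of `Q'` at `k = T`; passing
  -- to `k + 1` changes it only on `{τ = k}`.
  let q : ℕ → Ω → ℝ := fun k ω =>
    if τ ω < k then (Q'.rnDeriv P ω).toReal else (Q₁.rnDeriv P ω).toReal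
  have hstep : ∀ k ≤ T, (fun ω => q k ω • V ω) ∈ D := by
    intro k
    induction k with
    | zero =>
      intro _
      simpa [q] using hdens Q₁ hQ₁
    | succ k ih =>
      intro hk
      have hkT : k < T := hk
      have hmem := ih hkT.le
      let F : Set Ω := {ω | τ ω = k}
      have hF : MeasurableSet[ℱ k] F := hτ.measurableSet_eq k
      have hF' : MeasurableSet F := ℱ.le k F hF
      have hqk : ∀ ω ∈ F, q k ω = (Q₁.rnDeriv P ω).toReal := fun ω hω => by
        have : τ ω = k := hω
        simp [q, this]
      have hαY : (fun ω => F.indicator γ ω • ((Q₂.rnDeriv P ω).toReal • V ω)) =ᵐ[P]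
          F.indicator fun ω => (Q'.rnDeriv P ω).toReal • V ω := by
        filter_upwards [hγe] with ω hω
        by_cases hωF : ω ∈ F
        · have hτk : τ ω = k := hωF
          have : τ ω < T := by rw [hτk]; exact_mod_cast hkT
          simp only [hωF, Set.indicator_of_mem, hω this, mul_smul]
        · simp [hωF]
      have hq'V := hV.integrable_smul (Measure.integrable_toReal_rnDeriv (μ := Q') (ν := P))
      have hαYi : Integrable (fun ω => F.indicator γ ω • ((Q₂.rnDeriv P ω).toReal • V ω)) P :=
        (hq'V.indicator hF').congr hαY.symm
      have hβWi : Integrable (fun ω => (1 : ℝ) • (q k ω • V ω)) P := by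
        simpa only [one_smul] using hmem.1
      -- The current vector `q k · V` serves both as `W`, kept with `β = 1` off `{τ = k}`, and as
      -- the reference `Z`.
      have hX := hst k hkT.le _ (hdens Q₂ hQ₂) _ hmem _ hmem F hF (F.indicator γ) (fun _ => 1)
        (measurable_indicator_of_nextSigma hτ hkT hγ) measurable_const
        (fun ω => Set.indicator_nonneg (fun ω _ => hγ0 ω) ω) (fun _ => zero_le_one) hαYi hβWi
      have hXi := (hαYi.indicator hF').add (hβWi.indicator hF'.compl)
      refine dualCone_congr (hX (condExp_ae_eq_condExp_of_forall_setIntegral_eq (ℱ.le k) hXi hmem.1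
        fun A hA => ?_)) ?_
      · have hA' := ℱ.le k A hA
        rw [← integral_inter_add_sdiff hF' hXi.integrableOn,
          ← integral_inter_add_sdiff hF' hmem.1.integrableOn]
        congr 1
        -- `ℱ_k` and `ℱ_τ` have the same trace on `{τ = k}`, so the hypothesis on `E[V | ℱ_τ]`
        -- applies.
        · have hAF : MeasurableSet[hτ.measurableSpace] (A ∩ F) :=
            (hτ.measurableSet_inter_eq_iff A k).2 (hA.inter hF)
          calc _ = ∫ ω in A ∩ F, (Q'.rnDeriv P ω).toReal • V ω ∂P := by
                apply setIntegral_congr_ae (hA'.inter hF')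
                filter_upwards [hαY] with ω h1 h2
                simpa [h2.2] using h1
            _ = ∫ ω in A ∩ F, (Q₁.rnDeriv P ω).toReal • V ω ∂P := by
                rw [setIntegral_rnDeriv_smul hac' (hA'.inter hF'), hVeq _ hAF,
                  setIntegral_rnDeriv_smul hac1 (hA'.inter hF')]
            _ = _ := setIntegral_congr_fun (hA'.inter hF') fun ω hω => by
                simp only [hqk ω hω.2]
        · exact setIntegral_congr_fun (hA'.diff hF') fun ω hω => by simp [hω.2]
      · filter_upwards [hαY] with ω h1
        by_cases hωF : ω ∈ F
        · have hτk : τ ω = k := hωF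
          have : τ ω < ((k + 1 : ℕ) : WithTop ℕ) := by rw [hτk]; exact_mod_cast Nat.lt_succ_self k
          simp only [q, if_pos this]
          simpa [hωF] using h1
        · have hiff : τ ω < ((k + 1 : ℕ) : WithTop ℕ) ↔ τ ω < k := by
            have hne : τ ω ≠ k := hωF
            obtain ⟨n, hn⟩ : ∃ n : ℕ, τ ω = (n : WithTop ℕ) :=
              (WithTop.ne_top_iff_exists.1 ((hτT ω).trans_lt (WithTop.coe_lt_top T)).ne).imp
                fun _ h => h.symm
            rw [hn] at hne ⊢
            rw [Nat.cast_lt, Nat.cast_lt]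
            have : n ≠ k := fun h => hne (by rw [h])
            omega
          simp only [q, hiff]
          simp [hωF]
  have hQ'D : (fun ω => (Q'.rnDeriv P ω).toReal • V ω) ∈ D := by
    refine dualCone_congr (hstep T le_rfl) ?_
    filter_upwards [hfin] with ω hω
    by_cases hωT : τ ω < T
    · simp only [q, if_pos hωT]
    · simp only [q, if_neg hωT, hω (le_antisymm (hτT ω) (not_lt.1 hωT))]
  obtain ⟨c, hc, Q, hQ, hQe⟩ :=
    exists_eq_smul_density_of_mem_dualCone hV ⟨Q₁, hQ₁⟩ h𝒬 hconvex hclosed hQ'D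
  obtain ⟨hp, hac⟩ := h𝒬 Q hQ
  have he : (fun ω => (Q'.rnDeriv P ω).toReal) =ᵐ[P] fun ω => c * (Q.rnDeriv P ω).toReal := by
    filter_upwards [hQe, hV.ae_ne_zero] with ω h1 h2 using smul_left_injective ℝ h2 h1
  -- Both densities integrate to one.
  have hc1 : c = 1 := by
    have h1 := integral_congr_ae he
    rw [integral_const_mul, Measure.integral_toReal_rnDeriv hac,
      Measure.integral_toReal_rnDeriv hac'] at h1
    simpa using h1.symm
  have : Q' = Q := measure_eq_of_density_ae_eq hac' hac (by simpa [hc1] using he)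
  rwa [this]

theorem isPastingStable_dualCone_empty [IsProbabilityMeasure P] (hV : IsNumeraireVector P V) :
    IsPastingStable P ℱ T (dualCone P (attainingPortfolios P V (acceptanceSet P ∅))) := by
  intro t _ Y hY W hW Z _ F _ α β _ _ _ _ _ _ _
  have h0 : (0 : Ω → EuclideanSpace ℝ (Fin (d + 1))) ∈
      dualCone P (attainingPortfolios P V (acceptanceSet P ∅)) :=
    ⟨integrable_zero _ _ _, fun Y _ => by simp⟩
  refine dualCone_congr h0 ?_
  filter_upwards [ae_eq_zero_of_mem_dualCone_empty hV hY,
    ae_eq_zero_of_mem_dualCone_empty hV hW] with ω h1 h2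
  by_cases hω : ω ∈ F <;> simp [hω, h1, h2]

end Pasting

theorem mainTheorem5 {Ω : Type*} {mΩ : MeasurableSpace Ω} (P : Measure Ω) [IsProbabilityMeasure P]
    (T : ℕ) (ℱ : Filtration ℕ mΩ) (hℱ : ℱ T = mΩ)
    (d : ℕ) (V : Ω → EuclideanSpace ℝ (Fin (d + 1))) (hV : IsNumeraireVector P V)
    (hunit : ∃ η : EuclideanSpace ℝ (Fin (d + 1)), ∀ᵐ ω ∂P, inner ℝ η (V ω) = 1)
    (𝒬 : Set (Measure Ω)) (h𝒬 : ∀ Q ∈ 𝒬, IsProbabilityMeasure Q ∧ Q ≪ P)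
    (hconvex : Convex ℝ (densitySet P 𝒬)) (hclosed : IsClosed (densitySet P 𝒬)) :
    IsOptionallyMStable P ℱ T V 𝒬 ↔
      IsPastingStable P ℱ T
        (dualCone P (attainingPortfolios P V (acceptanceSet P 𝒬))) := by
  refine ⟨fun h => ?_, fun h => h.isOptionallyMStable hℱ hV h𝒬 hconvex hclosed⟩
  rcases 𝒬.eq_empty_or_nonempty with rfl | hne
  · exact isPastingStable_dualCone_empty hV
  · exact h.isPastingStable hV hunit h𝒬 hne hconvex hclosed
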